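/- Let $R$ be a local noetherian ring that is formally integral, that is, its formal completion $\hat R=\varprojlim_n R/\mathfrak m_R^n$ is an integral domain. Let $p\geq 1$ be the characteristic exponent of the field of fractions $\operatorname{Frac}(R)$ (so $p=1$ in characteristic zero, and $p$ equals the characteristic otherwise), and let $$R^{\mathrm{prc}}=\{b\in\hat R\mid b^{p^\nu}\in R\text{ for some }\nu\geq 0\}\subset\hat R$$ be the $p$-radical closure of $R$. Let $A\subset R^{\mathrm{prc}}$ be any $R$-subalgebra that is finitely generated as an $R$-module (such an $A$ is automatically a local ring, and the inclusion $R\subset A$ is a local homomorphism). Then the composite map $$\hat R\longrightarrow\hat A\longrightarrow(\hat A)_{\mathrm{red}}=\hat A/\operatorname{Nil}(\hat A)$$ is bijective, where $\hat A=\varprojlim_n A/\mathfrak m_A^n$ is the formal completion of $A$ and the first map is induced by the inclusion $R\subset A$. In other words, the reduced completion of $A$ is just $\hat R$. -/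

import Mathlib

open IsLocalRing

noncomputable section

namespace FormalCompletion

/-- The formal completion `R̂ = lim R / 𝔪ⁿ` of a local ring `R` with maximal ideal `𝔪`. -/
abbrev completion (R : Type*) [CommRing R] [IsLocalRing R] : Type _ :=
  AdicCompletion (maximalIdeal R) R

section Map

variable {R S : Type*} [CommRing R] [IsLocalRing R] [CommRing S] [IsLocalRing S]

theorem pow_le_comap (f : R →+* S) [IsLocalHom f] (n : ℕ) :
    maximalIdeal R ^ n ≤ (maximalIdeal S ^ n).comap f := by
  rw [← Ideal.map_le_iff_le_comap, Ideal.map_pow]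
  exact Ideal.pow_right_mono (((local_hom_TFAE f).out 0 2).mp ‹_›) n

/-- The maps `R̂ → R / 𝔪_Rⁿ → S / 𝔪_Sⁿ` induced by a local homomorphism `f : R → S`. -/
def completionToQuotient (f : R →+* S) [IsLocalHom f] (n : ℕ) :
    completion R →+* S ⧸ maximalIdeal S ^ n :=
  (Ideal.quotientMap (maximalIdeal S ^ n) f (pow_le_comap f n)).comp
    (AdicCompletion.evalₐ (maximalIdeal R) n : completion R →+* R ⧸ maximalIdeal R ^ n)

theorem factorPow_comp_completionToQuotient (f : R →+* S) [IsLocalHom f] {m n : ℕ} (hle : m ≤ n) :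
    (Ideal.Quotient.factorPow (maximalIdeal S) hle).comp (completionToQuotient f n) =
      completionToQuotient f m := by
  ext x
  obtain ⟨r, rfl⟩ := AdicCompletion.mk_surjective _ _ x
  have h : Ideal.Quotient.mk (maximalIdeal R ^ m) (r n) =
      Ideal.Quotient.mk (maximalIdeal R ^ m) (r m) := AdicCompletion.Ideal.mk_eq_mk _ hle r
  have h' : Ideal.Quotient.mk (maximalIdeal S ^ m) (f (r n)) =
      Ideal.Quotient.mk (maximalIdeal S ^ m) (f (r m)) := by
    simpa using congrArg (Ideal.quotientMap _ f (pow_le_comap f m)) h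
  simpa [completionToQuotient] using h'

/-- The map `R̂ → Ŝ` induced on formal completions by a local homomorphism `f : R → S`. It is the
inverse limit of the maps `R / 𝔪_Rⁿ → S / 𝔪_Sⁿ` induced by `f`. -/
def completionMap (f : R →+* S) [IsLocalHom f] : completion R →+* completion S :=
  AdicCompletion.liftRingHom (maximalIdeal S) (completionToQuotient f)
    (factorPow_comp_completionToQuotient f)

/-- `completionMap f` is compatible with the canonical maps `R → R̂` and `S → Ŝ`. -/
theorem completionMap_algebraMap (f : R →+* S) [IsLocalHom f] (r : R) :
    completionMap f (algebraMap R (completion R) r) = algebraMap S (completion S) (f r) := by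
  apply AdicCompletion.ext_evalₐ
  intro n
  rw [completionMap,
    AdicCompletion.evalₐ_liftRingHom _ _ (factorPow_comp_completionToQuotient f),
    AlgHom.commutes, completionToQuotient, RingHom.comp_apply, RingHom.coe_coe, AlgHom.commutes,
    Ideal.Quotient.algebraMap_eq, Ideal.Quotient.algebraMap_eq, Ideal.quotientMap_mk]

/-- The composite `R̂ → Ŝ → (Ŝ)_red = Ŝ / Nil(Ŝ)` attached to a local homomorphism `R → S`. -/
def toReducedCompletion (f : R →+* S) [IsLocalHom f] :
    completion R →+* completion S ⧸ nilradical (completion S) :=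
  (Ideal.Quotient.mk (nilradical (completion S))).comp (completionMap f)

end Map

/-- A local noetherian ring `R` is formally integral if `R̂` is an integral domain. -/
class IsFormallyIntegral (R : Type*) [CommRing R] [IsLocalRing R] [IsNoetherianRing R] : Prop where
  isDomain_completion : IsDomain (completion R)

section PRadicalClosure

variable (R : Type*) [CommRing R] [IsLocalRing R] [IsNoetherianRing R]

theorem algebraMap_injective : Function.Injective (algebraMap R (completion R)) := by
  have h := AdicCompletion.of_injective (maximalIdeal R) R
  exact h

instance [IsFormallyIntegral R] : IsDomain (completion R) :=
  IsFormallyIntegral.isDomain_completion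

instance (priority := low) isDomain [IsFormallyIntegral R] : IsDomain R :=
  (algebraMap_injective R).isDomain (algebraMap R (completion R))

/-- The characteristic exponent `p ≥ 1` of the field of fractions of `R`. -/
def charExponent [IsFormallyIntegral R] : ℕ := ringExpChar (FractionRing R)

instance [IsFormallyIntegral R] : ExpChar (completion R) (charExponent R) := by
  have h1 : ExpChar (FractionRing R) (charExponent R) := ringExpChar.expChar _
  have h2 : ExpChar R (charExponent R) :=
    (RingHom.expChar_iff _ (IsFractionRing.injective R (FractionRing R)) _).mpr h1
  exact expChar_of_injective_ringHom (algebraMap_injective R) _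

/-- The `p`-radical closure `R^prc = {b ∈ R̂ | b ^ (p ^ ν) ∈ R for some ν ≥ 0}`,
as an `R`-subalgebra of `R̂`; here `p` is the characteristic exponent of `Frac(R)`. -/
def pRadicalClosure [IsFormallyIntegral R] : Subalgebra R (completion R) :=
  Subalgebra.perfectClosure R (completion R) (charExponent R)

variable {R}

/-- For every intermediate ring `R ⊆ A ⊆ R̂` the inclusion `R → A` is local. -/
theorem isLocalHom_algebraMap (A : Subalgebra R (completion R)) : IsLocalHom (algebraMap R A) :=
  ⟨fun r hr ↦ isUnit_of_map_unit (algebraMap R (completion R)) r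
    (hr.map (algebraMap A (completion R)))⟩

theorem mem_pRadicalClosure_iff [IsFormallyIntegral R] {b : completion R} :
    b ∈ pRadicalClosure R ↔
      ∃ ν : ℕ, ∃ a : R, algebraMap R (completion R) a = b ^ charExponent R ^ ν :=
  Iff.rfl

variable [IsFormallyIntegral R] {A : Subalgebra R (completion R)}

/-- The inclusion of an intermediate ring `R ⊆ A ⊆ R^prc` into `R̂` reflects units. -/
theorem isLocalHom_val (hA : A ≤ pRadicalClosure R) :
    IsLocalHom (algebraMap A (completion R)) := by
  refine ⟨fun a ha ↦ ?_⟩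
  obtain ⟨ν, r, hr⟩ := mem_pRadicalClosure_iff.mp (hA a.2)
  have hu : IsUnit (algebraMap R (completion R) r) := by
    rw [hr]; exact ha.pow _
  have hr' : IsUnit r := isUnit_of_map_unit _ _ hu
  have h : a ^ charExponent R ^ ν = algebraMap R A r := Subtype.ext hr.symm
  have hp : charExponent R ^ ν ≠ 0 :=
    pow_ne_zero _ (expChar_pos (completion R) (charExponent R)).ne'
  exact (isUnit_pow_iff hp).mp (h ▸ hr'.map _)

/-- Every intermediate ring `R ⊆ A ⊆ R^prc` is a local ring. -/
theorem isLocalRing_of_le (hA : A ≤ pRadicalClosure R) : IsLocalRing A :=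
  haveI := isLocalHom_val hA
  RingHom.domain_isLocalRing (algebraMap A (completion R))

end PRadicalClosure

end FormalCompletion

end

open IsLocalRing

namespace FormalCompletion

variable {R : Type*} [CommRing R] [IsLocalRing R] [IsNoetherianRing R] [IsFormallyIntegral R]
  {A : Subalgebra R (completion R)}

/-! The inclusion `A ⊆ R̂` is continuous, so it extends to a ring map `ρ : Â → R̂`, the
`completionRetraction`, which is left inverse to `φ : R̂ → Â`. Since `R̂` is reduced, `ρ` kills
nilpotents, so `φ` stays injective modulo the nilradical. Finiteness of `A` gives a single power `q`
of `p` with `a ^ q ∈ R` for all `a ∈ A`; hence `φ (ρ y) ^ q = y ^ q`, and Frobenius gives `(φ (ρ y)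
- y) ^ q = 0`. Thus `φ` is surjective modulo nilpotents. -/

/-- A finite subalgebra of the `p`-radical closure has bounded height over `R`. -/
theorem exists_forall_pow_mem_range (hA : A ≤ pRadicalClosure R) [Module.Finite R A] :
    ∃ ν : ℕ, ∀ a : A, ∃ r : R, algebraMap R A r = a ^ charExponent R ^ ν := by
  have : ExpChar A (charExponent R) :=
    (RingHom.expChar_iff _ (FaithfulSMul.algebraMap_injective A (completion R)) _).mpr inferInstance
  have h (a : A) : ∃ ν : ℕ, ∃ r : R, algebraMap R A r = a ^ charExponent R ^ ν := by
    obtain ⟨ν, r, hr⟩ := mem_pRadicalClosure_iff.mp (hA a.2)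
    exact ⟨ν, r, Subtype.ext hr⟩
  choose ν hν using h
  obtain ⟨s, hs⟩ := Module.Finite.fg_top (R := R) (M := A)
  -- The largest exponent among the generators serves all of `A`, because `q`-th powers are
  -- additive.
  refine ⟨s.sup ν, fun a ↦ ?_⟩
  have ha : a ∈ Submodule.span R (s : Set A) := hs ▸ Submodule.mem_top
  induction ha using Submodule.span_induction with
  | mem x hx =>
    obtain ⟨r, hr⟩ := hν x
    obtain ⟨k, hk⟩ := Nat.exists_eq_add_of_le (Finset.le_sup (f := ν) hx)
    exact ⟨r ^ charExponent R ^ k, by rw [map_pow, hr, hk, pow_add, pow_mul]⟩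
  | zero =>
    exact ⟨0, by
      rw [map_zero, zero_pow (pow_ne_zero _ (expChar_pos A (charExponent R)).ne')]⟩
  | add x y _ _ hx hy =>
    obtain ⟨r, hr⟩ := hx
    obtain ⟨t, ht⟩ := hy
    exact ⟨r + t, by rw [map_add, hr, ht, add_pow_expChar_pow]⟩
  | smul c x _ hx =>
    obtain ⟨r, hr⟩ := hx
    exact ⟨c ^ charExponent R ^ _ * r, by rw [map_mul, map_pow, hr, Algebra.smul_def, mul_pow]⟩

/-- Non-units of `A` map to the maximal ideal at every finite level of `R̂`. -/
theorem evalₐ_mem_map_maximalIdeal [IsLocalRing A] (hA : A ≤ pRadicalClosure R) (n : ℕ) {a : A}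
    (ha : a ∈ maximalIdeal A) :
    AdicCompletion.evalₐ (maximalIdeal R) n (a : completion R) ∈
      (maximalIdeal R).map (Ideal.Quotient.mk (maximalIdeal R ^ n)) := by
  -- The end of the argument needs `𝔪ⁿ ≤ 𝔪`, hence `n > 0`; for `n = 0` the quotient is zero.
  rcases Nat.eq_zero_or_pos n with rfl | hn
  · have : Subsingleton (R ⧸ maximalIdeal R ^ 0) :=
      Ideal.Quotient.subsingleton_iff.mpr (by simp)
    rw [Subsingleton.elim (AdicCompletion.evalₐ (maximalIdeal R) 0 (a : completion R)) 0]
    exact zero_mem _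
  obtain ⟨ν, r, hr⟩ := mem_pRadicalClosure_iff.mp (hA a.2)
  have hpow : a ^ charExponent R ^ ν = algebraMap R A r := Subtype.ext hr.symm
  have hp : charExponent R ^ ν ≠ 0 :=
    pow_ne_zero _ (expChar_pos (completion R) (charExponent R)).ne'
  have hrm : r ∈ maximalIdeal R := by
    rw [mem_maximalIdeal, mem_nonunits_iff]
    intro hu
    exact (mem_maximalIdeal a).mp ha ((isUnit_pow_iff hp).mp (hpow ▸ hu.map _))
  -- A lift `s ∈ R` of the class of `a` has a power congruent to `r ∈ 𝔪` modulo `𝔪ⁿ`, so `s ∈ 𝔪` by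
  -- primality.
  obtain ⟨s, hs⟩ := Ideal.Quotient.mk_surjective
    (AdicCompletion.evalₐ (maximalIdeal R) n (a : completion R))
  rw [← hs]
  refine Ideal.mem_map_of_mem _ ((maximalIdeal.isMaximal R).isPrime.mem_of_pow_mem
    (charExponent R ^ ν) ?_)
  have hmk : Ideal.Quotient.mk (maximalIdeal R ^ n) (s ^ charExponent R ^ ν) =
      Ideal.Quotient.mk (maximalIdeal R ^ n) r := by
    rw [map_pow, hs, ← map_pow, ← hr, AlgHom.commutes, Ideal.Quotient.algebraMap_eq]
  have hsub := Ideal.pow_le_self hn.ne' (Ideal.Quotient.eq.mp hmk)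
  simpa using add_mem hsub hrm

/-- The map `A ⧸ 𝔪_Aⁿ → R ⧸ 𝔪_Rⁿ` induced by `A ⊆ R̂`. -/
noncomputable def quotientRetraction [IsLocalRing A] (hA : A ≤ pRadicalClosure R) (n : ℕ) :
    A ⧸ maximalIdeal A ^ n →+* R ⧸ maximalIdeal R ^ n :=
  Ideal.Quotient.lift (maximalIdeal A ^ n)
    ((AdicCompletion.evalₐ (maximalIdeal R) n : completion R →+* R ⧸ maximalIdeal R ^ n).comp
      (algebraMap A (completion R)))
    (by
      set f := (AdicCompletion.evalₐ (maximalIdeal R) n :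
        completion R →+* R ⧸ maximalIdeal R ^ n).comp (algebraMap A (completion R))
      have hle : (maximalIdeal A).map f ≤
          (maximalIdeal R).map (Ideal.Quotient.mk (maximalIdeal R ^ n)) :=
        Ideal.map_le_iff_le_comap.mpr fun a ha ↦ evalₐ_mem_map_maximalIdeal hA n ha
      have h : maximalIdeal A ^ n ≤ RingHom.ker f := by
        rw [RingHom.ker, ← Ideal.map_le_iff_le_comap, Ideal.map_pow]
        refine (Ideal.pow_right_mono hle n).trans ?_
        rw [← Ideal.map_pow, Ideal.map_quotient_self]
      exact fun a ha ↦ h ha)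

theorem quotientRetraction_mk [IsLocalRing A] (hA : A ≤ pRadicalClosure R) (n : ℕ) (a : A) :
    quotientRetraction hA n (Ideal.Quotient.mk _ a) =
      AdicCompletion.evalₐ (maximalIdeal R) n (a : completion R) :=
  rfl

theorem factorPow_comp_quotientRetraction [IsLocalRing A] (hA : A ≤ pRadicalClosure R) {m n : ℕ}
    (hle : m ≤ n) :
    (Ideal.Quotient.factorPow (maximalIdeal R) hle).comp
        ((quotientRetraction hA n).comp
          (AdicCompletion.evalₐ (maximalIdeal A) n : completion A →+* A ⧸ maximalIdeal A ^ n)) =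
      (quotientRetraction hA m).comp
        (AdicCompletion.evalₐ (maximalIdeal A) m : completion A →+* A ⧸ maximalIdeal A ^ m) := by
  ext x
  obtain ⟨a, rfl⟩ := AdicCompletion.mk_surjective _ _ x
  have h : Ideal.Quotient.mk (maximalIdeal A ^ m) (a n) =
      Ideal.Quotient.mk (maximalIdeal A ^ m) (a m) := AdicCompletion.Ideal.mk_eq_mk _ hle a
  have h' := congrArg (quotientRetraction hA m) h
  rw [quotientRetraction_mk, quotientRetraction_mk] at h'
  -- The term `a n` is itself an element of `R̂`, so it too is represented by a Cauchy sequence in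
  -- `R`.
  obtain ⟨r, hr⟩ := AdicCompletion.mk_surjective _ _ (a n : completion R)
  have h2 : Ideal.Quotient.mk (maximalIdeal R ^ m) (r n) =
      Ideal.Quotient.mk (maximalIdeal R ^ m) (r m) := AdicCompletion.Ideal.mk_eq_mk _ hle r
  rw [← hr] at h'
  simpa [quotientRetraction_mk, ← hr, ← h'] using h2

/-- The map `Â → R̂` extending the inclusion `A ⊆ R̂`. -/
noncomputable def completionRetraction [IsLocalRing A] (hA : A ≤ pRadicalClosure R) :
    completion A →+* completion R :=
  AdicCompletion.liftRingHom (maximalIdeal R)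
    (fun n ↦ (quotientRetraction hA n).comp
      (AdicCompletion.evalₐ (maximalIdeal A) n : completion A →+* A ⧸ maximalIdeal A ^ n))
    (factorPow_comp_quotientRetraction hA)

theorem evalₐ_completionRetraction [IsLocalRing A] (hA : A ≤ pRadicalClosure R) (n : ℕ)
    (y : completion A) :
    AdicCompletion.evalₐ (maximalIdeal R) n (completionRetraction hA y) =
      quotientRetraction hA n (AdicCompletion.evalₐ (maximalIdeal A) n y) := by
  rw [completionRetraction,
    AdicCompletion.evalₐ_liftRingHom _ _ (factorPow_comp_quotientRetraction hA)]
  rfl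

theorem evalₐ_completionMap {S T : Type*} [CommRing S] [IsLocalRing S] [CommRing T]
    [IsLocalRing T] (f : S →+* T) [IsLocalHom f] (n : ℕ) (x : completion S) :
    AdicCompletion.evalₐ (maximalIdeal T) n (completionMap f x) =
      Ideal.quotientMap (maximalIdeal T ^ n) f (pow_le_comap f n)
        (AdicCompletion.evalₐ (maximalIdeal S) n x) := by
  rw [completionMap, AdicCompletion.evalₐ_liftRingHom _ _ (factorPow_comp_completionToQuotient f)]
  rfl

theorem completionRetraction_completionMap [IsLocalRing A] [IsLocalHom (algebraMap R A)]
    (hA : A ≤ pRadicalClosure R) (x : completion R) :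
    completionRetraction hA (completionMap (algebraMap R A) x) = x := by
  apply AdicCompletion.ext_evalₐ
  intro n
  rw [evalₐ_completionRetraction, evalₐ_completionMap]
  obtain ⟨r, hr⟩ := Ideal.Quotient.mk_surjective (AdicCompletion.evalₐ (maximalIdeal R) n x)
  rw [← hr, Ideal.quotientMap_mk, quotientRetraction_mk]
  exact AlgHom.commutes (AdicCompletion.evalₐ (maximalIdeal R) n) r

/-- Modulo `𝔪_Aⁿ`, `y` is represented by some `a ∈ A`; its power `a ^ q` comes from `R`, where the
round trip is the identity. -/
theorem completionMap_completionRetraction_pow [IsLocalRing A] [IsLocalHom (algebraMap R A)]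
    (hA : A ≤ pRadicalClosure R) {q : ℕ} (hq : ∀ a : A, ∃ r : R, algebraMap R A r = a ^ q)
    (y : completion A) :
    completionMap (algebraMap R A) (completionRetraction hA y) ^ q = y ^ q := by
  apply AdicCompletion.ext_evalₐ
  intro n
  obtain ⟨a, ha⟩ := Ideal.Quotient.mk_surjective (AdicCompletion.evalₐ (maximalIdeal A) n y)
  obtain ⟨r, hr⟩ := hq a
  have hr' : (a : completion R) ^ q = algebraMap R (completion R) r := congrArg Subtype.val hr.symm
  rw [map_pow, map_pow, evalₐ_completionMap, evalₐ_completionRetraction, ← ha,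
    quotientRetraction_mk, ← map_pow, ← map_pow, hr', AlgHom.commutes,
    Ideal.Quotient.algebraMap_eq, Ideal.quotientMap_mk, hr, map_pow]

theorem bijective_toReducedCompletion [IsLocalRing A] [IsLocalHom (algebraMap R A)]
    (hA : A ≤ pRadicalClosure R) [Module.Finite R A] :
    Function.Bijective (toReducedCompletion (algebraMap R A)) := by
  have hleft := completionRetraction_completionMap hA
  constructor
  · rw [injective_iff_map_eq_zero]
    intro x hx
    have hnil : IsNilpotent (completionMap (algebraMap R A) x) :=
      mem_nilradical.mp (Ideal.Quotient.eq_zero_iff_mem.mp hx)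
    simpa only [hleft, isNilpotent_iff_eq_zero] using hnil.map (completionRetraction hA)
  · intro z
    obtain ⟨y, rfl⟩ := Ideal.Quotient.mk_surjective z
    obtain ⟨ν, hν⟩ := exists_forall_pow_mem_range hA
    -- `Â` inherits the characteristic exponent from `R̂`, which embeds in it.
    have : ExpChar (completion A) (charExponent R) :=
      expChar_of_injective_ringHom (Function.LeftInverse.injective hleft) _
    refine ⟨completionRetraction hA y, Ideal.Quotient.eq.mpr (mem_nilradical.mpr
      ⟨charExponent R ^ ν, ?_⟩)⟩
    rw [sub_pow_expChar_pow, completionMap_completionRetraction_pow hA hν, sub_self]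

end FormalCompletion

open FormalCompletion in
/-- For a formally integral local noetherian ring `R` and a finite `R`-subalgebra `A ⊆ R^prc`,
the composite `R̂ → Â → (Â)_red` is bijective. -/
theorem theorem3p2 (R : Type*) [CommRing R] [IsLocalRing R] [IsNoetherianRing R]
    [IsFormallyIntegral R] (A : Subalgebra R (completion R)) (hA : A ≤ pRadicalClosure R)
    (hfin : Module.Finite R A) :
    haveI : IsLocalRing A := isLocalRing_of_le hA
    haveI : IsLocalHom (algebraMap R A) := isLocalHom_algebraMap A
    Function.Bijective (toReducedCompletion (algebraMap R A)) :=

  letI : IsLocalRing A := isLocalRing_of_le hA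
  letI : IsLocalHom (algebraMap R A) := isLocalHom_algebraMap A
  bijective_toReducedCompletion hA
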